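/- Let $X$ be an abstract (reduced) complex analytic variety of finite dimension $n$: a Hausdorff, second countable space with a covering by open sets $A_l$ and homeomorphisms $F_l:A_l\to W_l$ onto holomorphic (closed) subvarieties $W_l$ of open sets $U_l\subseteq\mathbb C^{n_l}$, with biholomorphic coordinate changes, whose regular part $X'$ is an $n$-dimensional complex manifold. An atlas of $X$ is a covering of $X$ by domains of charts of the maximal atlas. A function on $X$ is holomorphic (resp. smooth) if locally, in charts, it extends to a holomorphic (resp. $C^\infty$) function on an open subset of the ambient $\mathbb C^{n_l}$; $\mathcal O_X$ and $\mathcal C^\infty_X$ denote the sheaves of complex valued holomorphic and smooth functions. (a) Let $\mathcal B=\{(B_\beta,n_\beta,U_\beta,W_\beta,F_\beta)\}_{\beta\in\mathfrak B}$ be an atlas of $X$ such that for every $\beta\in\mathfrak B$ there are only finitely many $\gamma\in\mathfrak B$ with $\overline{B_\gamma}\cap B_\beta\neq\emptyset$. Then there is a partition of unity $\{\rho_\beta:X\to\mathbb R\}_{\beta\in\mathfrak B}$ subordinate to $\mathcal B$ such that for all $\beta,\gamma\in\mathfrak B$ (in particular for $\gamma=\beta$) the function $\rho_\beta\circ F_\gamma^{-1}:W_\gamma\to\mathbb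 R$ extends to a $C^\infty$ function $U_\gamma\to\mathbb R$. Moreover each $\rho_\beta|_{X'}$ is an extendable $0$-form, i.e. $\rho_\beta|_{X'}\otimes 1$ is the restriction to $X'$ of a global section of the sheaf $\mathcal S_0$ defined below. (b) Let $\Omega_X$ be the sheaf of holomorphic differentials of $X$ (in a chart, $\Omega_{U}/(I\,\Omega_{U}+\mathcal O_{U}\,dI)$ with $I$ the ideal sheaf of the subvariety), $\Omega_X^p=\Lambda^p\Omega_X$, and $\mathcal O_X(\mathbf TX)$ the sheaf of holomorphic vector fields, i.e. of $\mathbb C$-derivations of $\mathcal O_X$. Then for all $N,N^*,p\in\mathbb N$ the sheaves $$\mathcal S_{N,N^*}=\bigl(\Omega_X^{\otimes N}\otimes_{\mathcal O_X}\mathcal O_X(\mathbf TX)^{\otimes N^*}\bigr)\otimes_{\mathcal O_X}\mathcal C_X^\infty\quad\text{and}\quad \mathcal S_p=\Omega_X^p\otimes_{\mathcal O_X}\mathcal C_X^\infty$$ are fine (for every locally finite open covering $\{V_i\}$ of $X$ there are sheaf endomorphisms $\eta_i$ with support in $V_i$ and $\sum_i\eta_i=1$) and soft (every section over a closed subset of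 $X$ extends to a global section). -/

import Mathlib

/-!
The space `X` is locally compact, because a holomorphic subvariety of an open set is locally closed
in `ℂᵐ`. Smooth bump functions of `ℂᵐ` with small support, pulled back by a chart and extended by
zero, are smooth on `X`. Summing locally finite families of them gives smooth functions that are
positive on a given closed set and vanish outside a given neighbourhood of it, hence a smooth
Urysohn lemma and, since `X` is paracompact, smooth partitions of unity `ρ i`.

Having a prescribed value at the points of `W`, and any value at the other points of `U`, is a
convex condition, so local smooth extensions of a function on `W` can be glued to a smooth function
on `U`.

Multiplication by `ρ i` is an endomorphism of `𝒮_{N,N*}` and of `𝒮_p`, and the sum of these is the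
identity: the sheaves are fine. If a section over a closed set `K` is locally given by sections
`t i` over open sets `U i`, and the partition of unity is subordinate to the covering by the `U i`
and by the complement of `K` (with section `0`), then `∑ ρ i • t i` extends it to `X`: the sheaves
are soft.
-/

open scoped Topology ContDiff TensorProduct
open TopologicalSpace Opposite

universe u

/-! ### Analytic subvarieties of open sets and local models -/

/-- `W` is a holomorphic (closed, reduced) subvariety of the open set `U ⊆ ℂᵐ`: near every point of
`U` it is the common zero set of finitely many holomorphic functions. -/
def IsHolomorphicSubvariety {m : ℕ} (U : Opens (Fin m → ℂ)) (W : Set (Fin m → ℂ)) : Prop :=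
  W ⊆ U ∧ ∀ z ∈ U, ∃ V : Opens (Fin m → ℂ), z ∈ V ∧ ∃ (k : ℕ) (f : Fin k → (Fin m → ℂ) → ℂ),
    (∀ j, AnalyticOnNhd ℂ (f j) V) ∧ W ∩ V = {w | w ∈ V ∧ ∀ j, f j w = 0}

/-- A local chart `(A, m, U, W, F)` of a space `X`: an open set `A ⊆ X` with a homeomorphism
`F : A → W` onto a holomorphic subvariety `W` of an open set `U ⊆ ℂᵐ`. -/
structure AnalyticChart (X : Type u) [TopologicalSpace X] where
  A : Opens X
  m : ℕ
  U : Opens (Fin m → ℂ)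
  W : Set (Fin m → ℂ)
  isSubvariety : IsHolomorphicSubvariety U W
  F : A ≃ₜ W

namespace AnalyticChart

variable {X : Type u} [TopologicalSpace X]

/-- The coordinate change from the chart `d` to the chart `c` is holomorphic: near every point of
the overlap it is the restriction of a holomorphic map of the ambient spaces. -/
def HolomorphicTransition (c d : AnalyticChart X) : Prop :=
  ∀ (x : X) (_ : x ∈ c.A) (hd : x ∈ d.A), ∃ G : (Fin d.m → ℂ) → (Fin c.m → ℂ),
    AnalyticAt ℂ G (d.F ⟨x, hd⟩) ∧
      ∀ᶠ y in 𝓝 x, ∀ (hyc : y ∈ c.A) (hyd : y ∈ d.A), G (d.F ⟨y, hyd⟩) = c.F ⟨y, hyc⟩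

/-- Two charts are compatible if the coordinate change is biholomorphic. -/
def Compatible (c d : AnalyticChart X) : Prop :=
  c.HolomorphicTransition d ∧ d.HolomorphicTransition c

end AnalyticChart

/-- An (abstract, reduced) complex analytic variety structure of dimension `n` on a topological
space `X`: a system of pairwise compatible charts covering `X` such that the regular part, i.e. the
part of `X` with charts onto open sets of some `ℂᵐ`, is a manifold of dimension `n`. The space `X`
is moreover required to be Hausdorff and second countable where such structures are used. -/
structure AnalyticVariety (n : ℕ) (X : Type u) [TopologicalSpace X] where
  charts : Set (AnalyticChart X)
  cover : ∀ x : X, ∃ c ∈ charts, x ∈ c.A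
  compatible : ∀ c ∈ charts, ∀ d ∈ charts, c.Compatible d
  dim_regular : ∀ c : AnalyticChart X, (∀ d ∈ charts, c.Compatible d) → IsOpen c.W →
    (c.A : Set X).Nonempty → c.m = n

/-! ### Algebra of germs of functions -/

/-- Germs of complex valued functions form a `ℂ`-algebra. -/
instance germComplexAlgebra {α : Type*} (l : Filter α) : Algebra ℂ (l.Germ ℂ) :=
  Algebra.ofModule
    (fun r a b => by
      induction a using Filter.Germ.inductionOn with | _ f
      induction b using Filter.Germ.inductionOn with | _ g
      exact congrArg _ (funext fun x => by simp [mul_assoc]))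
    (fun r a b => by
      induction a using Filter.Germ.inductionOn with | _ f
      induction b using Filter.Germ.inductionOn with | _ g
      exact congrArg _ (funext fun x => by simp [mul_left_comm]))

namespace AnalyticVariety

variable {n : ℕ} {X : Type u} [TopologicalSpace X] (𝒳 : AnalyticVariety n X)

/-- The maximal atlas: all charts compatible with the given ones. -/
def maximalAtlas : Set (AnalyticChart X) := {c | ∀ d ∈ 𝒳.charts, c.Compatible d}

/-- An atlas of `𝒳`: a family of charts in the maximal atlas whose domains cover `X`. -/
def IsAtlas {ι : Type*} (B : ι → AnalyticChart X) : Prop :=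
  (∀ i, B i ∈ 𝒳.maximalAtlas) ∧ ∀ x : X, ∃ i, x ∈ (B i).A

/-- The regular part `X'` of `𝒳`. -/
def regularPart : Opens X where
  carrier := {x | ∃ c ∈ 𝒳.maximalAtlas, IsOpen c.W ∧ x ∈ c.A}
  is_open' := isOpen_iff_mem_nhds.2 fun _ ⟨c, hc, hW, hx⟩ =>
    Filter.mem_of_superset (c.A.isOpen.mem_nhds hx) fun _ hy => ⟨c, hc, hW, hy⟩

/-- `f` is differentiable (i.e. smooth, `C^∞` in the real sense) around `x`: in each chart it
extends to a smooth function on a neighbourhood in the ambient space. -/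
def SmoothAt (f : X → ℂ) (x : X) : Prop :=
  ∀ c ∈ 𝒳.charts, ∀ hx : x ∈ c.A, ∃ (V : Opens (Fin c.m → ℂ)) (G : (Fin c.m → ℂ) → ℂ),
    (c.F ⟨x, hx⟩ : Fin c.m → ℂ) ∈ V ∧ ContDiffOn ℝ ∞ G V ∧
      ∀ᶠ y in 𝓝 x, ∀ hy : y ∈ c.A, f y = G (c.F ⟨y, hy⟩)

/-- `f` is holomorphic around `x`: in each chart it extends to a holomorphic function on a
neighbourhood in the ambient space. -/
def HolomorphicAt (f : X → ℂ) (x : X) : Prop :=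
  ∀ c ∈ 𝒳.charts, ∀ hx : x ∈ c.A, ∃ G : (Fin c.m → ℂ) → ℂ, AnalyticAt ℂ G (c.F ⟨x, hx⟩) ∧
    ∀ᶠ y in 𝓝 x, ∀ hy : y ∈ c.A, f y = G (c.F ⟨y, hy⟩)

variable {𝒳}

theorem HolomorphicAt.smoothAt {f : X → ℂ} {x : X} (h : 𝒳.HolomorphicAt f x) :
    𝒳.SmoothAt f x := by
  intro c hc hx
  obtain ⟨G, hG, hf⟩ := h c hc hx
  obtain ⟨V, hV, hVo, hxV⟩ := eventually_nhds_iff.1 hG.eventually_analyticAt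
  refine ⟨⟨V, hVo⟩, G, hxV, ?_, hf⟩
  intro z hz
  exact ((hV z hz).contDiffAt.restrict_scalars ℝ).contDiffWithinAt

variable (𝒳)

/-- The local ring `𝒪_{X,x}` of germs of holomorphic functions at `x`. -/
def O (x : X) : Subalgebra ℂ ((𝓝 x).Germ ℂ) where
  carrier := {φ | ∃ f : X → ℂ, 𝒳.HolomorphicAt f x ∧ (f : (𝓝 x).Germ ℂ) = φ}
  mul_mem' := by
    rintro _ _ ⟨f, hf, rfl⟩ ⟨g, hg, rfl⟩
    refine ⟨f * g, fun c hc hx => ?_, rfl⟩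
    obtain ⟨G, hG, hfG⟩ := hf c hc hx
    obtain ⟨H, hH, hgH⟩ := hg c hc hx
    refine ⟨G * H, hG.mul hH, ?_⟩
    filter_upwards [hfG, hgH] with y h1 h2 hy
    simp [h1 hy, h2 hy]
  add_mem' := by
    rintro _ _ ⟨f, hf, rfl⟩ ⟨g, hg, rfl⟩
    refine ⟨f + g, fun c hc hx => ?_, rfl⟩
    obtain ⟨G, hG, hfG⟩ := hf c hc hx
    obtain ⟨H, hH, hgH⟩ := hg c hc hx
    refine ⟨G + H, hG.add hH, ?_⟩
    filter_upwards [hfG, hgH] with y h1 h2 hy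
    simp [h1 hy, h2 hy]
  algebraMap_mem' r :=
    ⟨fun _ => r, fun _ _ _ => ⟨fun _ => r, analyticAt_const, by simp⟩, by
      rw [Algebra.algebraMap_eq_smul_one]
      exact congrArg _ (funext fun x => by simp)⟩

/-- The stalk `𝒞^∞_{X,x}` of germs of (complex valued) smooth functions at `x`. -/
def C (x : X) : Subalgebra ℂ ((𝓝 x).Germ ℂ) where
  carrier := {φ | ∃ f : X → ℂ, 𝒳.SmoothAt f x ∧ (f : (𝓝 x).Germ ℂ) = φ}
  mul_mem' := by
    rintro _ _ ⟨f, hf, rfl⟩ ⟨g, hg, rfl⟩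
    refine ⟨f * g, fun c hc hx => ?_, rfl⟩
    obtain ⟨V, G, hV, hG, hfG⟩ := hf c hc hx
    obtain ⟨V', H, hV', hH, hgH⟩ := hg c hc hx
    refine ⟨V ⊓ V', G * H, ⟨hV, hV'⟩, (hG.mono fun _ h => h.1).mul (hH.mono fun _ h => h.2), ?_⟩
    filter_upwards [hfG, hgH] with y h1 h2 hy
    simp [h1 hy, h2 hy]
  add_mem' := by
    rintro _ _ ⟨f, hf, rfl⟩ ⟨g, hg, rfl⟩
    refine ⟨f + g, fun c hc hx => ?_, rfl⟩
    obtain ⟨V, G, hV, hG, hfG⟩ := hf c hc hx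
    obtain ⟨V', H, hV', hH, hgH⟩ := hg c hc hx
    refine ⟨V ⊓ V', G + H, ⟨hV, hV'⟩, (hG.mono fun _ h => h.1).add (hH.mono fun _ h => h.2), ?_⟩
    filter_upwards [hfG, hgH] with y h1 h2 hy
    simp [h1 hy, h2 hy]
  algebraMap_mem' r :=
    ⟨fun _ => r, fun _ _ _ => ⟨⊤, fun _ => r, trivial, contDiffOn_const, by simp⟩, by
      rw [Algebra.algebraMap_eq_smul_one]
      exact congrArg _ (funext fun x => by simp)⟩

variable {𝒳}

/-- The germ at `x` of a function that is holomorphic around `x`. -/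
def holGerm (f : X → ℂ) {x : X} (h : 𝒳.HolomorphicAt f x) : 𝒳.O x := ⟨f, f, h, rfl⟩

/-- The germ at `x` of a function that is smooth around `x`. -/
def smoothGerm (f : X → ℂ) {x : X} (h : 𝒳.SmoothAt f x) : 𝒳.C x := ⟨f, f, h, rfl⟩

variable (𝒳)

theorem O_le_C (x : X) : 𝒳.O x ≤ 𝒳.C x := fun _ ⟨f, hf, h⟩ => ⟨f, hf.smoothAt, h⟩

/-- Smooth germs form an algebra over holomorphic germs, through the inclusion. -/
instance algebraOC (x : X) : Algebra (𝒳.O x) (𝒳.C x) :=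
  (Subalgebra.inclusion (𝒳.O_le_C x)).toRingHom.toAlgebra

/-! ### Holomorphic differentials and holomorphic vector fields -/

noncomputable section

/-- The relations that make the differential of functions on `X` obey the chain rule for all
holomorphic functions of several variables: if `h = Φ(g₁, …, g_k)` for a holomorphic `Φ`, then
`dh = ∑ⱼ (∂ⱼΦ)(g₁, …, g_k) dgⱼ`. -/
def chainRelations (x : X) : Submodule (𝒳.O x) (Ω[𝒳.O x⁄ℂ]) :=
  Submodule.span (𝒳.O x) {τ | ∃ (k : ℕ) (Φ : (Fin k → ℂ) → ℂ) (f : Fin k → X → ℂ)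
    (g : Fin k → 𝒳.O x) (h : 𝒳.O x) (h' : Fin k → 𝒳.O x),
    (∀ j, (f j : (𝓝 x).Germ ℂ) = g j) ∧ AnalyticAt ℂ Φ (fun j => f j x) ∧
    (h : (𝓝 x).Germ ℂ) = ((fun y => Φ fun i => f i y : X → ℂ) : (𝓝 x).Germ ℂ) ∧
    (∀ j, (h' j : (𝓝 x).Germ ℂ) =
      ((fun y => fderiv ℂ Φ (fun i => f i y) (Pi.single j 1) : X → ℂ) : (𝓝 x).Germ ℂ)) ∧
    τ = KaehlerDifferential.D ℂ (𝒳.O x) h - ∑ j, h' j • KaehlerDifferential.D ℂ (𝒳.O x) (g j)}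

/-- The stalk `Ω_{X,x}` of germs of holomorphic differentials: symbols `dg` for `g ∈ 𝒪_{X,x}`,
subject to linearity, the Leibniz rule and the holomorphic chain rule. In a chart with coordinates
`z₁, …, z_m` and ideal `I` of the subvariety this is the free `𝒪_{X,x}`-module on `dz₁, …, dz_m`
modulo the differentials `∑ ∂f/∂zᵢ dzᵢ` of the `f ∈ I`, i.e. the stalk of the usual coherent sheaf
`Ω_U / (I Ω_U + 𝒪_U dI)`. -/
abbrev Omega (x : X) : Type u := Ω[𝒳.O x⁄ℂ] ⧸ 𝒳.chainRelations x

/-- The differential `dg` of a holomorphic germ. -/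
def dGerm {x : X} (g : 𝒳.O x) : 𝒳.Omega x :=
  (𝒳.chainRelations x).mkQ (KaehlerDifferential.D ℂ (𝒳.O x) g)

/-- The stalk at `x` of the sheaf `𝒪_X(𝐓X)` of holomorphic vector fields: the derivations of the
local ring `𝒪_{X,x}`. -/
abbrev VectorField (x : X) : Type u := Derivation ℂ (𝒳.O x) (𝒳.O x)

/-- Holomorphic vector fields on the open set `V`, i.e. derivations of the sheaf `𝒪_X` over `V`:
families of derivations of the local rings that map holomorphic functions on open subsets of `V` to
holomorphic functions. -/
def IsHolomorphicVectorField (V : Opens X) (v : ∀ y : V, 𝒳.VectorField y) : Prop :=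
  ∀ (W : Opens X) (hWV : W ≤ V) (f : X → ℂ) (hf : ∀ y ∈ W, 𝒳.HolomorphicAt f y),
    ∃ g : X → ℂ, ∀ y (hy : y ∈ W),
      (v ⟨y, hWV hy⟩ (holGerm f (hf y hy)) : (𝓝 y).Germ ℂ) = (g : (𝓝 y).Germ ℂ)

end

end AnalyticVariety

/-! ### Sheaves of families of germs -/

/-- A rule that gives, on each open set, a set of families of elements of groups `T x` (`x ∈ X`),
stable under restriction. -/
structure FamilyGenerators (X : TopCat.{u}) (T : X → Type u) where
  gen : ∀ V : Opens X, Set (∀ y : V, T y)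
  res : ∀ {V V' : Opens X} (h : V' ≤ V), ∀ s ∈ gen V, (fun y : V' => s ⟨y, h y.2⟩) ∈ gen V'

namespace FamilyGenerators

variable {X : TopCat.{u}} {T : X → Type u} [∀ x, AddCommGroup (T x)] (P : FamilyGenerators X T)

/-- Being a finite sum of generators (and of their opposites). -/
def prelocal : TopCat.PrelocalPredicate T where
  pred {U} s := s ∈ AddSubgroup.closure (P.gen U)
  res {V U} i s hs := by
    let r : (∀ y : U, T y) →+ (∀ y : V, T y) :=
      { toFun := fun s y => s ⟨y, i.le y.2⟩
        map_zero' := rfl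
        map_add' := fun _ _ => rfl }
    have h : AddSubgroup.closure (P.gen U) ≤ (AddSubgroup.closure (P.gen V)).comap r :=
      (AddSubgroup.closure_le _).2 fun t ht => AddSubgroup.subset_closure (P.res i.le t ht)
    exact h hs

/-- The group of families over `U` that are locally finite sums of generators. -/
def sections (U : Opens X) : AddSubgroup (∀ y : U, T y) where
  carrier := {s | P.prelocal.sheafify.pred s}
  zero_mem' := fun x => ⟨U, x.2, CategoryTheory.CategoryStruct.id U, AddSubgroup.zero_mem _⟩
  add_mem' {a b} ha hb x := by
    obtain ⟨V, hV, i, h⟩ := ha x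
    obtain ⟨V', hV', i', h'⟩ := hb x
    exact ⟨V ⊓ V', ⟨hV, hV'⟩, CategoryTheory.homOfLE (le_trans inf_le_left i.le),
      AddSubgroup.add_mem _ (P.prelocal.res (CategoryTheory.homOfLE inf_le_left) _ h)
        (P.prelocal.res (CategoryTheory.homOfLE inf_le_right) _ h')⟩
  neg_mem' {a} ha x := by
    obtain ⟨V, hV, i, h⟩ := ha x
    exact ⟨V, hV, i, AddSubgroup.neg_mem _ h⟩

/-- The presheaf `U ↦ P.sections U`. -/
def presheaf : TopCat.Presheaf AddCommGrpCat.{u} X where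
  obj U := AddCommGrpCat.of (P.sections U.unop)
  map i := AddCommGrpCat.ofHom
    { toFun := fun s => ⟨fun y => s.1 (i.unop y), P.prelocal.sheafify.res i.unop s.1 s.2⟩
      map_zero' := rfl
      map_add' := fun _ _ => rfl }

/-- The sheaf of abelian groups whose sections are the families that are locally finite sums of
generators. -/
def sheaf : TopCat.Sheaf AddCommGrpCat.{u} X where
  obj := P.presheaf
  property := (TopCat.Presheaf.isSheaf_iff_isSheaf_comp
    (CategoryTheory.forget AddCommGrpCat.{u}) P.presheaf).2
    (TopCat.Presheaf.isSheaf_of_iso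
      (CategoryTheory.NatIso.ofComponents (fun _ => CategoryTheory.Iso.refl _) (fun _ => rfl))
      (TopCat.subpresheafToTypes.isSheaf P.prelocal.sheafify))

end FamilyGenerators

/-! ### Soft sheaves and fine sheaves -/

namespace TopCat.Sheaf

variable {X : TopCat.{u}} (F : TopCat.Sheaf AddCommGrpCat.{u} X)

/-- A sheaf is soft if every section over a closed set `K` extends to a global section. A section
over `K` is a family of germs at the points of `K` which, near each point of `K`, consists of the
germs of a section over an open set. -/
def IsSoft : Prop :=
  ∀ (K : Set X) (_ : IsClosed K) (s : ∀ x : K, F.presheaf.stalk (x : X)),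
    (∀ x : K, ∃ (U : Opens X) (_ : (x : X) ∈ U) (t : F.presheaf.obj (op U)),
      ∀ (y : K) (hy : (y : X) ∈ U), F.presheaf.germ U y hy t = s y) →
    ∃ t : F.presheaf.obj (op ⊤), ∀ y : K, F.presheaf.germ ⊤ y True.intro t = s y

/-- The additive map induced on the stalk at `x` by an endomorphism of a sheaf. -/
noncomputable def stalkEnd (η : F ⟶ F) (x : X) : F.presheaf.stalk x →+ F.presheaf.stalk x :=
  ((TopCat.Presheaf.stalkFunctor AddCommGrpCat.{u} x).map η.hom).hom

/-- A sheaf is fine if for every locally finite open covering `U` there are endomorphisms `η i` of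
the sheaf with support in `U i` (i.e. zero on the stalks over a neighbourhood of the complement of
`U i`) and with sum `1`. -/
def IsFine : Prop :=
  ∀ (ι : Type u) (U : ι → Opens X), LocallyFinite (fun i => (U i : Set X)) →
    (∀ x : X, ∃ i, x ∈ U i) →
    ∃ η : ι → (F ⟶ F), (∀ i, closure {x | F.stalkEnd (η i) x ≠ 0} ⊆ U i) ∧
      ∀ (x : X) (a : F.presheaf.stalk x), ∑ᶠ i, F.stalkEnd (η i) x a = a

end TopCat.Sheaf

/-! ### The sheaves of extendable tensors and forms -/

namespace AnalyticVariety

noncomputable section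

variable {n : ℕ} {X : Type u} [TopologicalSpace X] (𝒳 : AnalyticVariety n X)

/-- The stalk of `𝒮_p = Ω_X^p ⊗ 𝒞_X^∞` (tensor product over `𝒪_X`), with `Ω_X^p = Λ^p Ω_X`. The
factor `𝒞_X^∞` is written on the left. -/
abbrev FormStalk (p : ℕ) (x : X) : Type u := 𝒳.C x ⊗[𝒳.O x] ⋀[𝒳.O x]^p (𝒳.Omega x)

/-- The generators `c ⊗ (dg₁ ∧ … ∧ dg_p)` of `𝒮_p` on an open set, with `c` smooth and the `gⱼ`
holomorphic there. -/
def formGenerators (p : ℕ) : FamilyGenerators (TopCat.of X) (𝒳.FormStalk p) where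
  gen V := {s | ∃ (c : X → ℂ) (hc : ∀ y ∈ V, 𝒳.SmoothAt c y) (g : Fin p → X → ℂ)
    (hg : ∀ j, ∀ y ∈ V, 𝒳.HolomorphicAt (g j) y), ∀ y : V, s y =
      smoothGerm c (hc y y.2) ⊗ₜ[𝒳.O (y : X)]
        exteriorPower.ιMulti (𝒳.O (y : X)) p
          (fun j => 𝒳.dGerm (holGerm (g j) (hg j y y.2)))}
  res := by
    rintro V V' h s ⟨c, hc, g, hg, hs⟩
    exact ⟨c, fun y hy => hc y (h hy), g, fun j y hy => hg j y (h hy), fun y => hs ⟨y, h y.2⟩⟩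

/-- The sheaf `𝒮_p = Ω_X^p ⊗ 𝒞_X^∞`: the sheaf generated by the presheaf tensor product, realised
by families of elements of the stalks that are locally finite sums of elements
`c ⊗ (dg₁ ∧ … ∧ dg_p)`. -/
def formSheaf (p : ℕ) : TopCat.Sheaf AddCommGrpCat.{u} (TopCat.of X) := (𝒳.formGenerators p).sheaf

/-- The stalk of `𝒮_{N,N*} = (Ω_X^{⊗N} ⊗ 𝒪_X(𝐓X)^{⊗N*}) ⊗ 𝒞_X^∞` (tensor products over `𝒪_X`). The
factor `𝒞_X^∞` is written on the left. -/
abbrev TensorStalk (N N' : ℕ) (x : X) : Type u :=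
  𝒳.C x ⊗[𝒳.O x] ((⨂[𝒳.O x]^N (𝒳.Omega x)) ⊗[𝒳.O x] (⨂[𝒳.O x]^N' (𝒳.VectorField x)))

/-- The generators `c ⊗ ((dg₁ ⊗ … ⊗ dg_N) ⊗ (v₁ ⊗ … ⊗ v_{N*}))` of `𝒮_{N,N*}` on an open set, with
`c` smooth, the functions `gⱼ` and the vector fields `vⱼ` holomorphic there. -/
def tensorGenerators (N N' : ℕ) : FamilyGenerators (TopCat.of X) (𝒳.TensorStalk N N') where
  gen V := {s | ∃ (c : X → ℂ) (hc : ∀ y ∈ V, 𝒳.SmoothAt c y) (g : Fin N → X → ℂ)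
    (hg : ∀ j, ∀ y ∈ V, 𝒳.HolomorphicAt (g j) y)
    (v : Fin N' → ∀ y : V, 𝒳.VectorField (y : X)) (_ : ∀ j, 𝒳.IsHolomorphicVectorField V (v j)),
    ∀ y : V, s y =
      smoothGerm c (hc y y.2) ⊗ₜ[𝒳.O (y : X)]
        ((PiTensorProduct.tprod (𝒳.O (y : X))
            fun j => 𝒳.dGerm (holGerm (g j) (hg j y y.2))) ⊗ₜ[𝒳.O (y : X)]
          (PiTensorProduct.tprod (𝒳.O (y : X)) fun j => v j y))}
  res := by
    rintro V V' h s ⟨c, hc, g, hg, v, hv, hs⟩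
    exact ⟨c, fun y hy => hc y (h hy), g, fun j y hy => hg j y (h hy),
      fun j y => v j ⟨y, h y.2⟩,
      fun j W hW f hf => hv j W (hW.trans h) f hf, fun y => hs ⟨y, h y.2⟩⟩

/-- The sheaf `𝒮_{N,N*} = (Ω_X^{⊗N} ⊗ 𝒪_X(𝐓X)^{⊗N*}) ⊗ 𝒞_X^∞`, realised as for `𝒮_p`. -/
def tensorSheaf (N N' : ℕ) : TopCat.Sheaf AddCommGrpCat.{u} (TopCat.of X) :=
  (𝒳.tensorGenerators N N').sheaf

/-- A section of `𝒮_p` over the regular part is an extendable `p`-form if it is the restriction of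
a global section of `𝒮_p`. -/
def IsExtendableForm {p : ℕ} (s : (𝒳.formGenerators p).sections 𝒳.regularPart) : Prop :=
  ∃ t : (𝒳.formGenerators p).sections ⊤, ∀ y : 𝒳.regularPart, s.1 y = t.1 ⟨y, trivial⟩

/-- The function `f` on the regular part `X'` is an extendable `0`-form, functions being regarded
as sections of `𝒮_0` over `X'` through `f ↦ f ⊗ 1`. -/
def IsExtendableZeroForm (f : X → ℂ) : Prop :=
  ∃ s : (𝒳.formGenerators 0).sections 𝒳.regularPart, 𝒳.IsExtendableForm s ∧
    ∀ y : 𝒳.regularPart, ∃ h : 𝒳.SmoothAt f y,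
      s.1 y = smoothGerm f h ⊗ₜ[𝒳.O (y : X)] exteriorPower.ιMulti (𝒳.O (y : X)) 0 Fin.elim0

end

end AnalyticVariety

/-! ### Partitions of unity in algebras of continuous functions -/

theorem exists_locallyFinite_isCompact_subset_isOpen (X : Type*) [TopologicalSpace X]
    [T2Space X] [WeaklyLocallyCompactSpace X] [ParacompactSpace X] :
    ∃ K V : X → Set X, (∀ i, IsCompact (K i)) ∧ (∀ i, IsOpen (V i)) ∧ (∀ i, K i ⊆ V i) ∧
      LocallyFinite V ∧ ⋃ i, K i = Set.univ := by
  choose N hN hxN using fun x : X => exists_compact_mem_nhds x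
  obtain ⟨V, hVo, hVcov, hVfin, hVN⟩ := precise_refinement (fun x => interior (N x))
    (fun _ => isOpen_interior)
    (Set.iUnion_eq_univ_iff.2 fun x => ⟨x, mem_interior_iff_mem_nhds.2 (hxN x)⟩)
  obtain ⟨K, hKcov, hKc, hKV⟩ := exists_iUnion_eq_closed_subset hVo hVfin.point_finite hVcov
  exact ⟨K, V, fun i => (hN i).of_isClosed_subset (hKc i)
    ((hKV i).trans ((hVN i).trans interior_subset)), hVo, hKV, hVfin, hKcov⟩

/-- An algebra of continuous real valued functions that is determined locally and has enough bump
functions for the construction of partitions of unity, such as the algebra of smooth functions on a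
manifold or on an analytic variety. -/
structure IsBumpAlgebra {X : Type*} [TopologicalSpace X] (S : Subalgebra ℝ (X → ℝ)) : Prop where
  continuous_of_mem : ∀ f ∈ S, Continuous f
  mem_of_locally : ∀ f : X → ℝ, (∀ x, ∃ g ∈ S, f =ᶠ[𝓝 x] g) → f ∈ S
  inv_mem : ∀ f ∈ S, (∀ x, f x ≠ 0) → f⁻¹ ∈ S
  exists_bump : ∀ (x : X), ∀ N ∈ 𝓝 x, ∃ f ∈ S, 0 ≤ f ∧ 0 < f x ∧ tsupport f ⊆ N

namespace IsBumpAlgebra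

variable {X : Type*} [TopologicalSpace X] {S : Subalgebra ℝ (X → ℝ)}

theorem finsum_mem (hS : IsBumpAlgebra S) {ι : Type*} {f : ι → X → ℝ} (hf : ∀ i, f i ∈ S)
    (hfin : LocallyFinite fun i => Function.support (f i)) : (fun x => ∑ᶠ i, f i x) ∈ S := by
  refine hS.mem_of_locally _ fun x => ?_
  obtain ⟨I, hI⟩ := hfin.exists_finset_support x
  refine ⟨∑ i ∈ I, f i, sum_mem fun i _ => hf i, hI.mono fun y hy => ?_⟩
  rw [Finset.sum_apply]
  exact finsum_eq_sum_of_support_subset _ hy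

theorem exists_pos_on_isCompact (hS : IsBumpAlgebra S) {K O : Set X} (hK : IsCompact K)
    (hO : IsOpen O) (hKO : K ⊆ O) :
    ∃ f ∈ S, 0 ≤ f ∧ (∀ x ∈ K, 0 < f x) ∧ tsupport f ⊆ O := by
  refine hK.induction_on (p := fun s => ∃ f ∈ S, 0 ≤ f ∧ (∀ x ∈ s, 0 < f x) ∧ tsupport f ⊆ O)
    ⟨0, zero_mem S, le_rfl, by simp, by simp [tsupport]⟩ ?mono ?union ?nhds
  case mono =>
    rintro s t hst ⟨f, hf, hf0, hft, hfO⟩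
    exact ⟨f, hf, hf0, fun x hx => hft x (hst hx), hfO⟩
  case union =>
    rintro s t ⟨f, hf, hf0, hfs, hfO⟩ ⟨g, hg, hg0, hgt, hgO⟩
    refine ⟨f + g, add_mem hf hg, add_nonneg hf0 hg0, ?_,
      (tsupport_add f g).trans (Set.union_subset hfO hgO)⟩
    rintro x (hx | hx)
    · exact add_pos_of_pos_of_nonneg (hfs x hx) (hg0 x)
    · exact add_pos_of_nonneg_of_pos (hf0 x) (hgt x hx)
  case nhds =>
    intro x hx
    obtain ⟨f, hf, hf0, hfx, hfO⟩ := hS.exists_bump x O (hO.mem_nhds (hKO hx))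
    exact ⟨{y | 0 < f y}, mem_nhdsWithin_of_mem_nhds
      ((hS.continuous_of_mem f hf).continuousAt.eventually_const_lt hfx), f, hf, hf0,
      fun _ hy => hy, hfO⟩

variable [T2Space X] [LocallyCompactSpace X] [ParacompactSpace X]

theorem exists_pos_on_isClosed (hS : IsBumpAlgebra S) {C O : Set X} (hC : IsClosed C)
    (hO : IsOpen O) (hCO : C ⊆ O) :
    ∃ f ∈ S, 0 ≤ f ∧ (∀ x ∈ C, 0 < f x) ∧ Function.support f ⊆ O := by
  obtain ⟨K, V, hK, hVo, hKV, hVfin, hcov⟩ := exists_locallyFinite_isCompact_subset_isOpen X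
  choose f hf hf0 hfK hfV using fun i => hS.exists_pos_on_isCompact ((hK i).inter_right hC)
    ((hVo i).inter hO) (Set.inter_subset_inter (hKV i) hCO)
  have hsupp : ∀ i, Function.support (f i) ⊆ V i ∩ O := fun i =>
    (subset_tsupport _).trans (hfV i)
  have hfin : LocallyFinite fun i => Function.support (f i) :=
    hVfin.subset fun i => (hsupp i).trans Set.inter_subset_left
  refine ⟨fun x => ∑ᶠ i, f i x, hS.finsum_mem hf hfin, fun x => finsum_nonneg fun i => hf0 i x,
    fun x hx => ?_, fun x hx => ?_⟩
  · obtain ⟨i, hi⟩ := Set.iUnion_eq_univ_iff.1 hcov x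
    exact finsum_pos (fun i => hf0 i x) ⟨i, hfK i x ⟨hi, hx⟩⟩ (hfin.point_finite x)
  · obtain ⟨i, hi⟩ : ∃ i, f i x ≠ 0 := by
      by_contra! h
      exact hx (by simp only [h, finsum_zero])
    exact (hsupp i hi).2

theorem exists_urysohn (hS : IsBumpAlgebra S) {s t : Set X} (hs : IsClosed s) (ht : IsClosed t)
    (hst : Disjoint s t) :
    ∃ f ∈ S, Set.EqOn f 0 s ∧ Set.EqOn f 1 t ∧ ∀ x, f x ∈ Set.Icc (0 : ℝ) 1 := by
  obtain ⟨g, hg, hg0, hgt, hgs⟩ :=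
    hS.exists_pos_on_isClosed ht hs.isOpen_compl hst.subset_compl_left
  obtain ⟨h, hh, hh0, hhg, hht⟩ := hS.exists_pos_on_isClosed (C := {x | g x = 0})
    (isClosed_eq (hS.continuous_of_mem g hg) continuous_const) ht.isOpen_compl
    fun x hx hxt => (hgt x hxt).ne' hx
  have hpos : ∀ x, 0 < g x + h x := fun x =>
    (hg0 x).eq_or_lt.elim (fun h0 => add_pos_of_nonneg_of_pos (hg0 x) (hhg x h0.symm))
      fun hgx => add_pos_of_pos_of_nonneg hgx (hh0 x)
  refine ⟨g * (g + h)⁻¹, mul_mem hg (hS.inv_mem _ (add_mem hg hh) fun x => (hpos x).ne'),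
    fun x hx => ?_, fun x hx => ?_, fun x => ?_⟩
  · have hgx : g x = 0 := by_contra fun hne => hgs hne hx
    simp [hgx]
  · have hhx : h x = 0 := by_contra fun hne => hht hne hx
    simp [hhx, (hgt x hx).ne']
  · rw [Pi.mul_apply, Pi.inv_apply, Pi.add_apply, ← div_eq_mul_inv]
    exact ⟨div_nonneg (hg0 x) (hpos x).le,
      div_le_one_of_le₀ (le_add_of_nonneg_right (hh0 x)) (hpos x).le⟩

theorem exists_partitionOfUnity (hS : IsBumpAlgebra S) {ι : Type*} (U : ι → Set X)
    (hUo : ∀ i, IsOpen (U i)) (hU : ⋃ i, U i = Set.univ) :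
    ∃ ρ : PartitionOfUnity ι X, ρ.IsSubordinate U ∧ ∀ i, ⇑(ρ i) ∈ S := by
  classical
  obtain ⟨f, hf, hfU⟩ := BumpCovering.exists_isSubordinate_of_prop (· ∈ S)
    (fun s t hs ht hst => by
      obtain ⟨f, hf, hfst⟩ := hS.exists_urysohn hs ht hst
      exact ⟨⟨f, hS.continuous_of_mem f hf⟩, hf, hfst⟩)
    isClosed_univ U hUo hU.ge
  refine ⟨f.toPartitionOfUnity, hfU.toPartitionOfUnity, fun i => hS.mem_of_locally _ fun x => ?_⟩
  obtain ⟨I, hI⟩ := f.exists_finset_toPartitionOfUnity_eventuallyEq i x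
  refine ⟨f i * ∏ j ∈ I with WellOrderingRel j i, (1 - ⇑(f j)), ?_, ?_⟩
  · exact mul_mem (hf i) (prod_mem fun j _ => sub_mem (one_mem S) (hf j))
  · simpa using hI

end IsBumpAlgebra

/-! ### Topology of analytic varieties -/

theorem IsHolomorphicSubvariety.eventually_notMem {m : ℕ} {U : Opens (Fin m → ℂ)}
    {W : Set (Fin m → ℂ)} (h : IsHolomorphicSubvariety U W) {z : Fin m → ℂ} (hz : z ∈ U)
    (hzW : z ∉ W) : ∀ᶠ w in 𝓝 z, w ∉ W := by
  obtain ⟨V, hzV, k, f, hf, hW⟩ := h.2 z hz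
  obtain ⟨j, hj⟩ : ∃ j, f j z ≠ 0 := by
    by_contra! h0
    exact hzW (hW.symm.subset ⟨hzV, h0⟩ : z ∈ W ∩ V).1
  filter_upwards [V.isOpen.mem_nhds hzV, (hf j z hzV).continuousAt.eventually_ne hj]
    with w hwV hw hwW
  exact hw ((hW.subset ⟨hwW, hwV⟩).2 j)

theorem IsHolomorphicSubvariety.isLocallyClosed {m : ℕ} {U : Opens (Fin m → ℂ)}
    {W : Set (Fin m → ℂ)} (h : IsHolomorphicSubvariety U W) : IsLocallyClosed W := by
  have hUW : IsOpen ((U : Set (Fin m → ℂ)) \ W) := isOpen_iff_mem_nhds.2 fun z hz =>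
    Filter.inter_mem (U.isOpen.mem_nhds hz.1) (h.eventually_notMem hz.1 hz.2)
  refine ⟨U, _, U.isOpen, hUW.isClosed_compl, ?_⟩
  rw [← Set.sdiff_eq, Set.sdiff_sdiff_cancel_left h.1]

theorem AnalyticVariety.locallyCompactSpace {n : ℕ} {X : Type u} [TopologicalSpace X] [T2Space X]
    (𝒳 : AnalyticVariety n X) : LocallyCompactSpace X := by
  have : WeaklyLocallyCompactSpace X := ⟨fun x => by
    obtain ⟨c, -, hx⟩ := 𝒳.cover x
    have := c.isSubvariety.isLocallyClosed.locallyCompactSpace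
    have := c.F.isClosedEmbedding.locallyCompactSpace
    obtain ⟨K, hK, hKx⟩ := exists_compact_mem_nhds (⟨x, hx⟩ : c.A)
    exact ⟨_, hK.image continuous_subtype_val,
      c.A.isOpen.isOpenEmbedding_subtypeVal.isOpenMap.image_mem_nhds hKx⟩⟩
  infer_instance

/-! ### Smooth functions in charts -/

theorem exists_contDiffOn_eqOn_of_local {E F : Type*} [NormedAddCommGroup E] [NormedSpace ℝ E]
    [FiniteDimensional ℝ E] [NormedAddCommGroup F] [NormedSpace ℝ F] {k : ℕ∞} {U : Opens E}
    {S : Set E} {f : E → F}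
    (h : ∀ z ∈ U, ∃ V ∈ 𝓝 z, ∃ G : E → F, ContDiffOn ℝ k G V ∧ Set.EqOn G f (S ∩ V)) :
    ∃ R : E → F, ContDiffOn ℝ k R U ∧ Set.EqOn R f (S ∩ U) := by
  have : LocallyCompactSpace U := U.isOpen.locallyCompactSpace
  have hconvex : ∀ z : U, Convex ℝ {a : F | (z : E) ∈ S → a = f z} := fun z => by
    by_cases hz : (z : E) ∈ S
    · simpa only [hz, true_imp_iff, Set.ofPred_eq_eq_singleton] using convex_singleton (f z)
    · simpa only [hz, false_imp_iff, Set.ofPred_true] using convex_univ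
  obtain ⟨g, hg⟩ := exists_contMDiffMap_forall_mem_convex_of_local (n := k)
    (modelWithCornersSelf ℝ E) hconvex fun z => by
      obtain ⟨V, hV, G, hG, hGf⟩ := h z z.2
      exact ⟨_, continuous_subtype_val.continuousAt.preimage_mem_nhds hV, fun y => G y,
        hG.contMDiffOn.comp contMDiff_subtype_val.contMDiffOn fun _ hy => hy,
        fun y hy hyS => hGf ⟨hyS, hy⟩⟩
  have hR : ∀ z : U, Function.extend ((↑) : U → E) g 0 z = g z :=
    Subtype.val_injective.extend_apply g 0
  refine ⟨Function.extend ((↑) : U → E) g 0, fun z hz => ?_, fun z hz =>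
    (hR ⟨z, hz.2⟩).trans (hg ⟨z, hz.2⟩ hz.1)⟩
  refine ContDiffAt.contDiffWithinAt ?_
  rw [← contMDiffAt_iff_contDiffAt, ← contMDiffAt_subtype_iff (x := (⟨z, hz⟩ : U))]
  exact (g.contMDiff _).congr_of_eventuallyEq (.of_forall hR)

namespace AnalyticChart

variable {X : Type u} [TopologicalSpace X] {c : AnalyticChart X}

/-- `f` extends, in the chart `c`, to a smooth function on a neighbourhood of `c.F x`. This is the
condition that `AnalyticVariety.SmoothAt` imposes on each chart of the variety. It is void if `x`
is not in the domain of `c`. -/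
def SmoothAt (c : AnalyticChart X) (f : X → ℂ) (x : X) : Prop :=
  ∀ hx : x ∈ c.A, ∃ (V : Opens (Fin c.m → ℂ)) (G : (Fin c.m → ℂ) → ℂ),
    (c.F ⟨x, hx⟩ : Fin c.m → ℂ) ∈ V ∧ ContDiffOn ℝ ∞ G V ∧
      ∀ᶠ y in 𝓝 x, ∀ hy : y ∈ c.A, f y = G (c.F ⟨y, hy⟩)

theorem SmoothAt.of_transition {d : AnalyticChart X} {f : X → ℂ} {x : X} (h : d.SmoothAt f x)
    (hd : x ∈ d.A) (hdc : d.HolomorphicTransition c) : c.SmoothAt f x := by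
  intro hc
  obtain ⟨V, G, hV, hG, hf⟩ := h hd
  obtain ⟨H, hH, hHF⟩ := hdc x hd hc
  have hHx := hHF.self_of_nhds hd hc
  have hev : ∀ᶠ z in 𝓝 (c.F ⟨x, hc⟩ : Fin c.m → ℂ), AnalyticAt ℂ H z ∧ H z ∈ V :=
    hH.eventually_analyticAt.and
      (hH.continuousAt.eventually (V.isOpen.mem_nhds (by rwa [hHx])))
  obtain ⟨V', hV', hVo, hxV⟩ := eventually_nhds_iff.1 hev
  refine ⟨⟨V', hVo⟩, G ∘ H, hxV, hG.comp (fun z hz =>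
    ((hV' z hz).1.contDiffAt.restrict_scalars ℝ).contDiffWithinAt) fun z hz => (hV' z hz).2, ?_⟩
  filter_upwards [hf, hHF, d.A.isOpen.mem_nhds hd] with y hfy hHy hyd hyc
  rw [hfy hyd, Function.comp_apply, hHy hyd hyc]

theorem SmoothAt.continuousAt {f : X → ℂ} {x : X} (h : c.SmoothAt f x)
    (hx : x ∈ c.A) : ContinuousAt f x := by
  obtain ⟨V, G, hV, hG, hf⟩ := h hx
  have hGF : ContinuousAt (fun y : c.A => G (c.F y)) ⟨x, hx⟩ :=
    ContinuousAt.comp (f := fun y : c.A => (c.F y : Fin c.m → ℂ)) (g := G)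
      (hG.continuousOn.continuousAt (V.isOpen.mem_nhds hV))
      (continuous_subtype_val.comp c.F.continuous).continuousAt
  rw [← c.A.isOpen.isOpenEmbedding_subtypeVal.continuousAt_iff (x := ⟨x, hx⟩)]
  refine hGF.congr ?_
  filter_upwards [continuous_subtype_val.continuousAt.eventually hf] with y hy
  exact (hy y.2).symm

theorem SmoothAt.exists_contDiffOn_eqOn {f : X → ℝ} {x : X} (hx : x ∈ c.A)
    (h : c.SmoothAt (fun y => (f y : ℂ)) x) :
    ∃ V ∈ 𝓝 (c.F ⟨x, hx⟩ : Fin c.m → ℂ), ∃ G : (Fin c.m → ℂ) → ℝ, ContDiffOn ℝ ∞ G V ∧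
      ∀ w : c.W, (w : Fin c.m → ℂ) ∈ V → G w = f (c.F.symm w) := by
  obtain ⟨V, G, hxV, hG, hf⟩ := h hx
  have hfG : ∀ᶠ w : c.W in 𝓝 (c.F ⟨x, hx⟩), G w = f (c.F.symm w) := by
    have htendsto : Filter.Tendsto (fun w => (c.F.symm w : X)) (𝓝 (c.F ⟨x, hx⟩)) (𝓝 x) :=
      (continuous_subtype_val.comp c.F.symm.continuous).tendsto' _ _ (by simp)
    filter_upwards [htendsto.eventually hf] with w hw
    simpa using (hw (c.F.symm w).2).symm
  rw [nhds_subtype_eq_comap] at hfG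
  obtain ⟨N, hN, hNG⟩ := Filter.mem_comap.1 hfG
  refine ⟨N ∩ V, Filter.inter_mem hN (V.isOpen.mem_nhds hxV), fun z => (G z).re,
    (Complex.reCLM.contDiff.comp_contDiffOn hG).mono Set.inter_subset_right, fun w hw => ?_⟩
  simpa using congrArg Complex.re (hNG hw.1)

theorem exists_contDiffOn_extension {f : X → ℝ}
    (h : ∀ x, c.SmoothAt (fun y => (f y : ℂ)) x) :
    ∃ R : (Fin c.m → ℂ) → ℝ, ContDiffOn ℝ ∞ R c.U ∧ ∀ w : c.W, R w = f (c.F.symm w) := by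
  let fW : (Fin c.m → ℂ) → ℝ := Function.extend ((↑) : c.W → Fin c.m → ℂ)
    (fun w => f (c.F.symm w)) 0
  have hfW : ∀ w : c.W, fW w = f (c.F.symm w) := Subtype.val_injective.extend_apply _ _
  obtain ⟨R, hR, hRf⟩ := exists_contDiffOn_eqOn_of_local (U := c.U) (S := c.W) (k := ⊤)
    (f := fW) fun z hz => by
      by_cases hzW : z ∈ c.W
      · obtain ⟨V, hV, G, hG, hGf⟩ := (h _).exists_contDiffOn_eqOn (c.F.symm ⟨z, hzW⟩).2
        refine ⟨V, by simpa using hV, G, hG, fun w hw => ?_⟩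
        exact (hGf ⟨w, hw.1⟩ hw.2).trans (hfW ⟨w, hw.1⟩).symm
      · exact ⟨_, c.isSubvariety.eventually_notMem hz hzW, 0, contDiffOn_const,
          fun w hw => absurd hw.1 hw.2⟩
  exact ⟨R, hR, fun w => (hRf ⟨w.2, c.isSubvariety.1 w.2⟩).trans (hfW w)⟩

/-- The function `φ ∘ F` on the domain of the chart `c`, extended by zero to `X`. It is used for
functions `φ` with support small enough for the extension to be smooth. -/
noncomputable def pullback (c : AnalyticChart X) (φ : (Fin c.m → ℂ) → ℝ) : X → ℝ :=
  Function.extend ((↑) : c.A → X) (fun y => φ (c.F y)) 0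

theorem pullback_apply (φ : (Fin c.m → ℂ) → ℝ) (y : c.A) : c.pullback φ y = φ (c.F y) :=
  Subtype.val_injective.extend_apply _ _ _

theorem support_pullback_subset (φ : (Fin c.m → ℂ) → ℝ) :
    Function.support (c.pullback φ) ⊆ (↑) '' {y : c.A | (c.F y : Fin c.m → ℂ) ∈ tsupport φ} := by
  intro y hy
  have hyA : y ∈ c.A := by
    by_contra h
    exact hy (Function.extend_apply' _ _ _ (by simpa using h))
  exact ⟨⟨y, hyA⟩, subset_tsupport φ (by simpa [pullback_apply φ ⟨y, hyA⟩] using hy), rfl⟩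

theorem pullback_nonneg {φ : (Fin c.m → ℂ) → ℝ} (hφ : 0 ≤ φ) : 0 ≤ c.pullback φ := by
  intro y
  by_cases hy : y ∈ c.A
  · exact (hφ _).trans_eq (pullback_apply φ ⟨y, hy⟩).symm
  · exact (Function.extend_apply' _ _ _ (by simpa using hy)).ge

end AnalyticChart

/-! ### The algebra of smooth functions -/

namespace AnalyticVariety

variable {n : ℕ} {X : Type u} [TopologicalSpace X] {𝒳 : AnalyticVariety n X}

theorem smoothAt_of_chart {c : AnalyticChart X} (hc : c ∈ 𝒳.maximalAtlas) {f : X → ℂ} {x : X}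
    (hx : x ∈ c.A) (h : c.SmoothAt f x) : 𝒳.SmoothAt f x :=
  fun d hd => h.of_transition hx (hc d hd).1

namespace SmoothAt

variable {f : X → ℂ} {x : X}

theorem chart {c : AnalyticChart X} (hc : c ∈ 𝒳.maximalAtlas) (h : 𝒳.SmoothAt f x) :
    c.SmoothAt f x := by
  obtain ⟨d, hd, hx⟩ := 𝒳.cover x
  exact AnalyticChart.SmoothAt.of_transition (h d hd) hx (hc d hd).2

theorem continuousAt (h : 𝒳.SmoothAt f x) : ContinuousAt f x := by
  obtain ⟨d, hd, hx⟩ := 𝒳.cover x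
  exact AnalyticChart.SmoothAt.continuousAt (h d hd) hx

theorem congr {g : X → ℂ} (h : 𝒳.SmoothAt f x) (hfg : g =ᶠ[𝓝 x] f) : 𝒳.SmoothAt g x := by
  intro c hc hx
  obtain ⟨V, G, hV, hG, hf⟩ := h c hc hx
  refine ⟨V, G, hV, hG, ?_⟩
  filter_upwards [hf, hfg] with y hfy hfgy hy
  rw [hfgy, hfy hy]

theorem inv (hf : 𝒳.SmoothAt f x) (h0 : f x ≠ 0) : 𝒳.SmoothAt (fun y => (f y)⁻¹) x := by
  intro c hc hx
  obtain ⟨V, G, hV, hG, hfG⟩ := hf c hc hx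
  have hev : ∀ᶠ z in 𝓝 (c.F ⟨x, hx⟩ : Fin c.m → ℂ), z ∈ V ∧ G z ≠ 0 :=
    Filter.Eventually.and (V.isOpen.mem_nhds hV)
      ((hG.continuousOn.continuousAt (V.isOpen.mem_nhds hV)).eventually_ne
        (by rwa [← hfG.self_of_nhds hx]))
  obtain ⟨V', hV', hVo, hxV⟩ := eventually_nhds_iff.1 hev
  refine ⟨⟨V', hVo⟩, fun z => (G z)⁻¹, hxV,
    (hG.mono fun z hz => (hV' z hz).1).inv fun z hz => (hV' z hz).2, ?_⟩
  filter_upwards [hfG] with y hfy hy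
  rw [hfy hy]

end SmoothAt

theorem smoothAt_iff_coe_mem_C {f : X → ℂ} {x : X} :
    𝒳.SmoothAt f x ↔ (f : (𝓝 x).Germ ℂ) ∈ 𝒳.C x :=
  ⟨fun h => ⟨f, h, rfl⟩, fun ⟨_, hg, hgf⟩ => hg.congr (Filter.Germ.coe_eq.1 hgf.symm)⟩

theorem smoothAt_const (a : ℂ) (x : X) : 𝒳.SmoothAt (fun _ => a) x :=
  fun _ _ _ => ⟨⊤, fun _ => a, trivial, contDiffOn_const, by simp⟩

theorem SmoothAt.add {f g : X → ℂ} {x : X} (hf : 𝒳.SmoothAt f x) (hg : 𝒳.SmoothAt g x) :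
    𝒳.SmoothAt (fun y => f y + g y) x :=
  smoothAt_iff_coe_mem_C.2
    (add_mem (smoothAt_iff_coe_mem_C.1 hf) (smoothAt_iff_coe_mem_C.1 hg))

theorem SmoothAt.mul {f g : X → ℂ} {x : X} (hf : 𝒳.SmoothAt f x) (hg : 𝒳.SmoothAt g x) :
    𝒳.SmoothAt (fun y => f y * g y) x :=
  smoothAt_iff_coe_mem_C.2
    (mul_mem (smoothAt_iff_coe_mem_C.1 hf) (smoothAt_iff_coe_mem_C.1 hg))

variable (𝒳) in
/-- The algebra of the real valued functions that are smooth on the whole of `X`. -/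
def smoothFunctions : Subalgebra ℝ (X → ℝ) where
  carrier := {f | ∀ x, 𝒳.SmoothAt (fun y => (f y : ℂ)) x}
  mul_mem' hf hg x := by simpa using (hf x).mul (hg x)
  add_mem' hf hg x := by simpa using (hf x).add (hg x)
  algebraMap_mem' r := smoothAt_const (r : ℂ)

theorem pullback_mem_smoothFunctions {c : AnalyticChart X} (hc : c ∈ 𝒳.maximalAtlas)
    {φ : (Fin c.m → ℂ) → ℝ} (hφ : ContDiff ℝ ∞ φ) (hsupp : tsupport (c.pullback φ) ⊆ c.A) :
    c.pullback φ ∈ 𝒳.smoothFunctions := by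
  intro x
  by_cases hx : x ∈ tsupport (c.pullback φ)
  · exact smoothAt_of_chart hc (hsupp hx) fun _ => ⟨⊤, fun z => (φ z : ℂ), trivial,
      (Complex.ofRealCLM.contDiff.comp hφ).contDiffOn,
      .of_forall fun y hy => congrArg _ (c.pullback_apply φ ⟨y, hy⟩)⟩
  · refine (smoothAt_const 0 x).congr ?_
    filter_upwards [notMem_tsupport_iff_eventuallyEq.1 hx] with y hy
    exact congrArg _ hy

theorem exists_bump_mem_smoothFunctions [T2Space X] (𝒳 : AnalyticVariety n X) (x : X) {N : Set X}
    (hN : N ∈ 𝓝 x) : ∃ f ∈ 𝒳.smoothFunctions, 0 ≤ f ∧ 0 < f x ∧ tsupport f ⊆ N := by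
  obtain ⟨c, hc, hx⟩ := 𝒳.cover x
  have := 𝒳.locallyCompactSpace
  obtain ⟨K, hK, hKN, hKc⟩ := local_compact_nhds
    (Filter.inter_mem hN (c.A.isOpen.mem_nhds hx))
  have hKA : ((↑) : c.A → X) ⁻¹' K ∈ 𝓝 (⟨x, hx⟩ : c.A) :=
    continuous_subtype_val.continuousAt.preimage_mem_nhds hK
  rw [(Topology.IsInducing.subtypeVal.comp c.F.isInducing).nhds_eq_comap] at hKA
  obtain ⟨t, ht, htK⟩ := Filter.mem_comap.1 hKA
  obtain ⟨φ, hφt, -, hφ, hφ01, hφx⟩ := exists_contDiff_tsupport_subset (n := ⊤) ht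
  have hsupp : tsupport (c.pullback φ) ⊆ K := by
    refine closure_minimal ((c.support_pullback_subset φ).trans ?_) hKc.isClosed
    rintro _ ⟨y, hy, rfl⟩
    exact htK (hφt hy)
  refine ⟨c.pullback φ, pullback_mem_smoothFunctions (𝒳.compatible c hc) hφ
    (hsupp.trans (hKN.trans Set.inter_subset_right)),
    AnalyticChart.pullback_nonneg fun z => (hφ01 ⟨z, rfl⟩).1, ?_,
    hsupp.trans (hKN.trans Set.inter_subset_left)⟩
  rw [c.pullback_apply φ ⟨x, hx⟩]
  exact zero_lt_one.trans_eq hφx.symm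

theorem isBumpAlgebra_smoothFunctions [T2Space X] (𝒳 : AnalyticVariety n X) :
    IsBumpAlgebra 𝒳.smoothFunctions where
  continuous_of_mem f hf := continuous_iff_continuousAt.2 fun x => by
    simpa [Function.comp_def] using Complex.continuous_re.continuousAt.comp (hf x).continuousAt
  mem_of_locally f hf x := by
    obtain ⟨g, hg, hfg⟩ := hf x
    exact (hg x).congr (hfg.fun_comp Complex.ofReal)
  inv_mem f hf h0 x := by simpa using (hf x).inv (Complex.ofReal_ne_zero.2 (h0 x))
  exists_bump x _ hN := 𝒳.exists_bump_mem_smoothFunctions x hN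

end AnalyticVariety

/-! ### Partitions of unity in sheaves of families of germs -/

theorem exists_finset_eventually_forall_mem {ι X : Type*} [TopologicalSpace X] {s : ι → Set X}
    (hs : LocallyFinite s) (x : X) : ∃ I : Finset ι, ∀ᶠ y in 𝓝 x, ∀ i, y ∈ s i → i ∈ I := by
  obtain ⟨N, hN, hfin⟩ := hs x
  exact ⟨hfin.toFinset, Filter.mem_of_superset hN fun y hy i hi => hfin.mem_toFinset.2 ⟨y, hi, hy⟩⟩

namespace FamilyGenerators

open CategoryTheory TopCat.Presheaf

variable {X : TopCat.{u}} {T : X → Type u} [∀ x, AddCommGroup (T x)] (P : FamilyGenerators X T)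

theorem mem_sections_of_mem_gen {U : Opens X} {s : ∀ y : U, T y} (hs : s ∈ P.gen U) :
    s ∈ P.sections U :=
  fun x => ⟨U, x.2, 𝟙 U, AddSubgroup.subset_closure hs⟩

theorem res_mem_sections {U V : Opens X} (h : V ≤ U) {s : ∀ y : U, T y} (hs : s ∈ P.sections U) :
    (fun y : V => s ⟨y, h y.2⟩) ∈ P.sections V :=
  P.prelocal.sheafify.res (homOfLE h) s hs

theorem mem_sections_of_local {U : Opens X} {s : ∀ y : U, T y}
    (h : ∀ x ∈ U, ∃ (V : Opens X) (hVU : V ≤ U), x ∈ V ∧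
      (fun y : V => s ⟨y, hVU y.2⟩) ∈ P.sections V) : s ∈ P.sections U := by
  intro x
  obtain ⟨V, hVU, hxV, hV⟩ := h x x.2
  obtain ⟨W, hW, i, hi⟩ := hV ⟨x, hxV⟩
  exact ⟨W, hW, i ≫ homOfLE hVU, hi⟩

theorem finsum_mem_sections {ι : Type*} {U : Opens X} {s : ι → ∀ y : U, T y}
    (hs : ∀ i, s i ∈ P.sections U) (hfin : LocallyFinite fun i => {y | s i y ≠ 0}) :
    (fun y => ∑ᶠ i, s i y) ∈ P.sections U := by
  refine P.mem_sections_of_local fun x hx => ?_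
  obtain ⟨I, hI⟩ := exists_finset_eventually_forall_mem hfin ⟨x, hx⟩
  obtain ⟨N, hN, hNo, hxN⟩ := eventually_nhds_iff.1 hI
  let V : Opens X := ⟨(↑) '' N, U.isOpen.isOpenMap_subtype_val N hNo⟩
  have hVU : V ≤ U := SetLike.coe_subset_coe.1 (Subtype.coe_image_subset (U : Set X) N)
  have hV : (fun y : V => ∑ᶠ i, s i ⟨y, hVU y.2⟩) = fun y : V => (∑ i ∈ I, s i) ⟨y, hVU y.2⟩ := by
    funext ⟨_, y, hy, rfl⟩
    rw [Finset.sum_apply]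
    exact finsum_eq_sum_of_support_subset _ (hN y hy)
  exact ⟨V, hVU, ⟨_, hxN, rfl⟩, hV ▸ P.res_mem_sections hVU (sum_mem fun i _ => hs i)⟩

variable {P}

/-- The germ at `x` of a section of the sheaf of families. -/
noncomputable def germ {U : Opens X} (x : X) (hx : x ∈ U) :
    P.sections U →+ P.sheaf.presheaf.stalk x :=
  (P.sheaf.presheaf.germ U x hx).hom

theorem exists_germ_eq {x : X} (a : P.sheaf.presheaf.stalk x) :
    ∃ (U : Opens X) (hx : x ∈ U) (s : P.sections U), germ x hx s = a :=
  TopCat.Presheaf.exists_germ_eq P.sheaf.presheaf a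

theorem germ_eq_germ_iff {U V : Opens X} {x : X} (hU : x ∈ U) (hV : x ∈ V) {s : P.sections U}
    {t : P.sections V} : germ x hU s = germ x hV t ↔
      ∀ᶠ y in 𝓝 x, ∀ (hyU : y ∈ U) (hyV : y ∈ V), s.1 ⟨y, hyU⟩ = t.1 ⟨y, hyV⟩ := by
  refine ⟨fun h => ?_, fun h => ?_⟩
  · obtain ⟨W, hxW, iU, iV, hW⟩ := TopCat.Presheaf.germ_eq P.sheaf.presheaf x hU hV s t h
    filter_upwards [W.isOpen.mem_nhds hxW] with y hy _ _
    exact congrFun (congrArg Subtype.val hW) ⟨y, hy⟩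
  · obtain ⟨N, hN, hNo, hxN⟩ := eventually_nhds_iff.1 h
    refine TopCat.Presheaf.germ_ext P.sheaf.presheaf (U ⊓ V ⊓ ⟨N, hNo⟩) ⟨⟨hU, hV⟩, hxN⟩
      (homOfLE fun y hy => hy.1.1) (homOfLE fun y hy => hy.1.2) ?_
    exact Subtype.ext (funext fun y => hN y y.2.2 y.2.1.1 y.2.1.2)

/-- The additive maps `m x` of the groups of values, applied pointwise, map sections to sections. -/
def PreservesSections (P : FamilyGenerators X T) (m : ∀ x, T x →+ T x) : Prop :=
  ∀ (U : Opens X), ∀ s ∈ P.sections U, (fun y : U => m y (s y)) ∈ P.sections U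

variable {m : ∀ x, T x →+ T x}

theorem preservesSections_of_gen
    (hm : ∀ (U : Opens X), ∀ s ∈ P.gen U, (fun y : U => m y (s y)) ∈ P.gen U) :
    P.PreservesSections m := by
  intro U s hs x
  obtain ⟨V, hV, i, h⟩ := hs x
  have hmap : AddSubgroup.closure (P.gen V) ≤
      (AddSubgroup.closure (P.gen V)).comap (AddMonoidHom.piMap fun y : V => m y) :=
    (AddSubgroup.closure_le _).2 fun t ht => AddSubgroup.subset_closure (hm V t ht)
  exact ⟨V, hV, i, hmap h⟩

/-- The endomorphism of the sheaf of families given by additive maps of the groups of values that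
preserve sections. -/
def endOfMap (m : ∀ x, T x →+ T x) (hm : P.PreservesSections m) : P.sheaf ⟶ P.sheaf where
  hom :=
    { app U := AddCommGrpCat.ofHom
        { toFun := fun s : P.sections U.unop => (⟨_, hm U.unop s.1 s.2⟩ : P.sections U.unop)
          map_zero' := Subtype.ext (funext fun y => (m y).map_zero)
          map_add' := fun _ _ => Subtype.ext (funext fun y => (m y).map_add _ _) }
      naturality := fun _ _ _ => rfl }

theorem stalkEnd_endOfMap_germ (hm : P.PreservesSections m) {U : Opens X} {x : X} (hx : x ∈ U)
    (s : P.sections U) : P.sheaf.stalkEnd (endOfMap m hm) x (germ x hx s) =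
      germ x hx ⟨fun y => m y (s.1 y), hm U s.1 s.2⟩ :=
  stalkFunctor_map_germ_apply (F := P.sheaf.presheaf) (G := P.sheaf.presheaf) U x hx
    (endOfMap m hm).hom s

theorem stalkEnd_endOfMap_eq_zero (hm : P.PreservesSections m) {x : X}
    (h : ∀ᶠ y in 𝓝 x, m y = 0) : P.sheaf.stalkEnd (endOfMap m hm) x = 0 := by
  ext a
  obtain ⟨U, hx, s, rfl⟩ := exists_germ_eq a
  rw [stalkEnd_endOfMap_germ, AddMonoidHom.zero_apply, ← map_zero (germ (P := P) x hx),
    germ_eq_germ_iff]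
  filter_upwards [h] with y hy hyU _
  exact DFunLike.congr_fun hy _

open Classical in
/-- The family `s` on the open set `V`, extended by zero to `X`. It need not be a section. -/
noncomputable def extendByZero {V : Opens X} (s : ∀ y : V, T y) (x : X) : T x :=
  if h : x ∈ V then s ⟨x, h⟩ else 0

theorem map_extendByZero_mem_sections (hm : P.PreservesSections m) {V : Opens X}
    (hmV : closure {x | m x ≠ 0} ⊆ V) {s : ∀ y : V, T y} (hs : s ∈ P.sections V) :
    (fun y : (⊤ : Opens X) => m y (extendByZero s y)) ∈ P.sections ⊤ := by
  refine P.mem_sections_of_local fun x _ => ?_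
  by_cases hx : x ∈ V
  · refine ⟨V, le_top, hx, ?_⟩
    convert hm V s hs using 3 with y
    exact dif_pos y.2
  · let O : Opens X := ⟨(closure {x | m x ≠ 0})ᶜ, isClosed_closure.isOpen_compl⟩
    have h0 : (fun y : O => m y (extendByZero s y)) = 0 := funext fun y =>
      DFunLike.congr_fun (by_contra fun h => y.2 (subset_closure h) : m y = 0) _
    exact ⟨O, le_top, fun h => hx (hmV h), h0 ▸ (P.sections O).zero_mem⟩

theorem eventually_map_extendByZero_eq {U V : Opens X} (hmV : closure {x | m x ≠ 0} ⊆ V)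
    {s : P.sections V} {t : P.sections U} {x : X} (hxU : x ∈ U)
    (hst : ∀ hx : x ∈ V, germ x hx s = germ x hxU t) :
    ∀ᶠ y in 𝓝 x, ∀ hy : y ∈ U, m y (extendByZero s.1 y) = m y (t.1 ⟨y, hy⟩) := by
  by_cases hx : x ∈ closure {x | m x ≠ 0}
  · filter_upwards [(germ_eq_germ_iff (hmV hx) hxU).1 (hst (hmV hx)),
      V.isOpen.mem_nhds (hmV hx)] with y hsty hyV hyU
    exact congrArg (m y) ((dif_pos hyV).trans (hsty hyV hyU))
  · filter_upwards [isClosed_closure.isOpen_compl.mem_nhds hx] with y hy hyU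
    have hmy : m y = 0 := by_contra fun h => hy (subset_closure h)
    simp only [hmy, AddMonoidHom.zero_apply]

/-- A partition of unity for the sheaf of families `P`, subordinate to the open sets `U i`: the
additive maps `m i x` of the groups of values are, for each `i`, an endomorphism of the sheaf that
vanishes near the complement of `U i`, and locally they are a finite sum decomposition of the
identity. -/
structure IsPartitionOfUnity (P : FamilyGenerators X T) {ι : Type*} (U : ι → Opens X)
    (m : ι → ∀ x, T x →+ T x) : Prop where
  preservesSections : ∀ i, P.PreservesSections (m i)
  closure_subset : ∀ i, closure {x | m i x ≠ 0} ⊆ U i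
  locallyFinite : LocallyFinite fun i => {x | m i x ≠ 0}
  finsum_eq : ∀ x a, ∑ᶠ i, m i x a = a

namespace IsPartitionOfUnity

variable {ι : Type*} {U : ι → Opens X} {m : ι → ∀ x, T x →+ T x}

theorem finsum_stalkEnd_endOfMap (h : P.IsPartitionOfUnity U m) {x : X}
    (a : P.sheaf.presheaf.stalk x) :
    ∑ᶠ i, P.sheaf.stalkEnd (endOfMap (m i) (h.preservesSections i)) x a = a := by
  obtain ⟨I, hI⟩ := exists_finset_eventually_forall_mem h.locallyFinite x
  have hsupp : (Function.support fun i =>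
      P.sheaf.stalkEnd (endOfMap (m i) (h.preservesSections i)) x a) ⊆ I := fun i hi => by
    by_contra hiI
    refine hi (DFunLike.congr_fun (stalkEnd_endOfMap_eq_zero _ ?_) a)
    exact hI.mono fun y hy => by_contra fun hne => hiI (hy i hne)
  obtain ⟨V, hx, s, rfl⟩ := exists_germ_eq a
  rw [finsum_eq_sum_of_support_subset _ hsupp]
  simp only [stalkEnd_endOfMap_germ]
  rw [← map_sum, germ_eq_germ_iff]
  filter_upwards [hI] with y hy hyV _
  rw [AddSubgroup.val_finsetSum, Finset.sum_apply]
  refine (finsum_eq_sum_of_support_subset _ fun i hi => hy i fun h0 => hi ?_).symm.trans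
    (h.finsum_eq y (s.1 ⟨y, hyV⟩))
  exact DFunLike.congr_fun h0 _

theorem exists_section_germ_eq (h : P.IsPartitionOfUnity U m) (s : ∀ i, P.sections (U i)) :
    ∃ r : P.sections ⊤, ∀ (V : Opens X) (x : X) (hxV : x ∈ V) (t : P.sections V),
      (∀ i (hx : x ∈ U i), germ x hx (s i) = germ x hxV t) →
        germ x (Opens.mem_top x) r = germ x hxV t := by
  have hfin : LocallyFinite fun i =>
      {y : (⊤ : Opens X) | m i y (extendByZero (s i).1 y) ≠ 0} :=
    (h.locallyFinite.preimage_continuous continuous_subtype_val).subset fun i y hy h0 =>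
      hy (DFunLike.congr_fun h0 _)
  refine ⟨⟨_, P.finsum_mem_sections (fun i => map_extendByZero_mem_sections
    (h.preservesSections i) (h.closure_subset i) (s i).2) hfin⟩, fun V x hxV t hst => ?_⟩
  obtain ⟨I, hI⟩ := exists_finset_eventually_forall_mem h.locallyFinite x
  have hterm : ∀ᶠ y in 𝓝 x, ∀ i ∈ I, ∀ hy : y ∈ V,
      m i y (extendByZero (s i).1 y) = m i y (t.1 ⟨y, hy⟩) :=
    I.eventually_all.2 fun i _ =>
      eventually_map_extendByZero_eq (h.closure_subset i) hxV (hst i)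
  rw [germ_eq_germ_iff]
  filter_upwards [hI, hterm] with y hyI hy _ hyV
  refine (finsum_congr fun i => ?_).trans (h.finsum_eq y (t.1 ⟨y, hyV⟩))
  by_cases hi : m i y = 0
  · simp only [hi, AddMonoidHom.zero_apply]
  · exact hy i (hyI i hi) hyV

end IsPartitionOfUnity

/-- Every open covering has a subordinate partition of unity for the sheaf of families `P`. -/
def HasPartitionsOfUnity (P : FamilyGenerators X T) : Prop :=
  ∀ (ι : Type u) (U : ι → Opens X), (∀ x, ∃ i, x ∈ U i) → ∃ m, P.IsPartitionOfUnity U m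

theorem HasPartitionsOfUnity.isFine (hP : P.HasPartitionsOfUnity) : P.sheaf.IsFine := by
  intro ι U _ hU
  obtain ⟨m, hm⟩ := hP ι U hU
  refine ⟨fun i => endOfMap (m i) (hm.preservesSections i), fun i => ?_,
    fun _ => hm.finsum_stalkEnd_endOfMap⟩
  refine (closure_minimal (fun x hx => ?_) isClosed_closure).trans (hm.closure_subset i)
  by_contra hxm
  refine hx (stalkEnd_endOfMap_eq_zero _ ?_)
  filter_upwards [isClosed_closure.isOpen_compl.mem_nhds hxm] with y hy
  exact by_contra fun hne => hy (subset_closure hne)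

theorem HasPartitionsOfUnity.isSoft (hP : P.HasPartitionsOfUnity) : P.sheaf.IsSoft := by
  intro K hK s hs
  choose U hxU t ht using hs
  let V : Option K → Opens X := fun i => i.elim ⟨Kᶜ, hK.isOpen_compl⟩ U
  let τ : ∀ i, P.sections (V i) := fun
    | none => 0
    | some x => t x
  have hτ : ∀ i (y : K) (hy : (y : X) ∈ V i), germ (y : X) hy (τ i) = s y := fun
    | none, y, hy => absurd y.2 hy
    | some x, y, hy => ht x y hy
  obtain ⟨m, hm⟩ := hP (Option K) V fun x => by
    by_cases hx : x ∈ K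
    · exact ⟨some ⟨x, hx⟩, hxU ⟨x, hx⟩⟩
    · exact ⟨none, hx⟩
  obtain ⟨r, hr⟩ := hm.exists_section_germ_eq τ
  refine ⟨r, fun y => ?_⟩
  exact (hr _ _ (hxU y) (t y) fun i hy => (hτ i y hy).trans (ht y y (hxU y)).symm).trans
    (ht y y (hxU y))

end FamilyGenerators

/-! ### Sheaves of modules over the smooth functions -/

namespace AnalyticVariety

open FamilyGenerators

variable {n : ℕ} {X : Type u} [TopologicalSpace X] {𝒳 : AnalyticVariety n X}

theorem smoothGerm_eq_zero {f : X → ℂ} {x : X} (h : 𝒳.SmoothAt f x) (h0 : f =ᶠ[𝓝 x] 0) :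
    smoothGerm f h = 0 :=
  Subtype.ext (Filter.Germ.coe_eq.2 h0)

theorem sum_smoothGerm_eq_one {ι : Type*} {I : Finset ι} {f : ι → X → ℂ} {x : X}
    (h : ∀ i, 𝒳.SmoothAt (f i) x) (h1 : ∀ᶠ y in 𝓝 x, ∑ i ∈ I, f i y = 1) :
    ∑ i ∈ I, smoothGerm (f i) (h i) = 1 := by
  refine Subtype.ext ?_
  rw [AddSubmonoidClass.coe_finsetSum]
  change ∑ i ∈ I, Filter.Germ.coeRingHom (𝓝 x) (f i) = _
  rw [← map_sum]
  exact Filter.Germ.coe_eq.2 (h1.mono fun y hy => by simpa using hy)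

theorem finsum_smoothGerm_smul {ι : Type*} (ρ : PartitionOfUnity ι X)
    (hρ : ∀ i, ⇑(ρ i) ∈ 𝒳.smoothFunctions) {x : X} {M : Type*} [AddCommGroup M]
    [Module (𝒳.C x) M] (a : M) : ∑ᶠ i, smoothGerm _ (hρ i x) • a = a := by
  obtain ⟨I, hI⟩ := ρ.exists_finset_nhds x
  have hsupp : (Function.support fun i => smoothGerm _ (hρ i x) • a) ⊆ I := fun i hi => by
    by_contra hiI
    refine hi ?_
    have h0 : (fun y => (ρ i y : ℂ)) =ᶠ[𝓝 x] 0 := hI.mono fun y hy =>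
      Complex.ofReal_eq_zero.2 (by_contra fun hne => hiI (hy.2 hne))
    simp only [smoothGerm_eq_zero (hρ i x) h0, zero_smul]
  rw [finsum_eq_sum_of_support_subset _ hsupp, ← Finset.sum_smul,
    sum_smoothGerm_eq_one (fun i => hρ i x), one_smul]
  filter_upwards [hI] with y hy
  exact_mod_cast hy.1

/-- The generators are stable under multiplication by global smooth functions, so that the sheaf
that they generate is a sheaf of modules over the smooth functions. -/
def SmoothStable (𝒳 : AnalyticVariety n X) {T : X → Type u} [∀ x, AddCommGroup (T x)]
    [∀ x, Module (𝒳.C x) (T x)] (P : FamilyGenerators (TopCat.of X) T) : Prop :=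
  ∀ (f : X → ℂ) (hf : ∀ x, 𝒳.SmoothAt f x) (V : Opens X), ∀ s ∈ P.gen V,
    (fun y : V => smoothGerm f (hf y) • s y) ∈ P.gen V

theorem SmoothStable.hasPartitionsOfUnity [T2Space X] [ParacompactSpace X] {T : X → Type u}
    [∀ x, AddCommGroup (T x)] [∀ x, Module (𝒳.C x) (T x)]
    {P : FamilyGenerators (TopCat.of X) T} (hP : 𝒳.SmoothStable P) : P.HasPartitionsOfUnity := by
  intro ι U hU
  have := 𝒳.locallyCompactSpace
  obtain ⟨ρ, hρU, hρ⟩ := 𝒳.isBumpAlgebra_smoothFunctions.exists_partitionOfUnity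
    (fun i => (U i : Set X)) (fun i => (U i).isOpen) (Set.iUnion_eq_univ_iff.2 hU)
  have hsupp : ∀ i, {x | DistribSMul.toAddMonoidHom (T x) (smoothGerm _ (hρ i x)) ≠ 0} ⊆
      tsupport (ρ i) := fun i x hx => by
    by_contra hxρ
    refine hx (AddMonoidHom.ext fun a => ?_)
    have h0 : (fun y => (ρ i y : ℂ)) =ᶠ[𝓝 x] 0 :=
      (notMem_tsupport_iff_eventuallyEq.1 hxρ).mono fun y hy => Complex.ofReal_eq_zero.2 hy
    exact (congrArg (· • a) (smoothGerm_eq_zero (hρ i x) h0)).trans (zero_smul _ a)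
  exact ⟨fun i x => DistribSMul.toAddMonoidHom (T x) (smoothGerm _ (hρ i x)),
    { preservesSections := fun i => preservesSections_of_gen (X := TopCat.of X) (hP _ (hρ i))
      closure_subset := fun i => (closure_minimal (hsupp i) (isClosed_tsupport _)).trans (hρU i)
      locallyFinite := ρ.locallyFinite.closure.subset hsupp
      finsum_eq := fun _ => finsum_smoothGerm_smul ρ hρ }⟩

theorem smoothStable_formGenerators (p : ℕ) : 𝒳.SmoothStable (𝒳.formGenerators p) := by
  rintro f hf V s ⟨c, hc, g, hg, hs⟩
  refine ⟨fun y => f y * c y, fun y hy => (hf y).mul (hc y hy), g, hg, fun y => ?_⟩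
  exact (congrArg (smoothGerm f (hf y) • ·) (hs y)).trans
    (TensorProduct.smul_tmul' (smoothGerm f (hf y)) _ _)

theorem smoothStable_tensorGenerators (N N' : ℕ) : 𝒳.SmoothStable (𝒳.tensorGenerators N N') := by
  rintro f hf V s ⟨c, hc, g, hg, v, hv, hs⟩
  refine ⟨fun y => f y * c y, fun y hy => (hf y).mul (hc y hy), g, hg, v, hv, fun y => ?_⟩
  exact (congrArg (smoothGerm f (hf y) • ·) (hs y)).trans
    (TensorProduct.smul_tmul' (smoothGerm f (hf y)) _ _)

theorem isExtendableZeroForm_of_smoothAt {f : X → ℂ} (hf : ∀ x, 𝒳.SmoothAt f x) :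
    𝒳.IsExtendableZeroForm f := by
  let t : ∀ U : Opens X, ∀ y : U, 𝒳.FormStalk 0 y := fun _ y =>
    smoothGerm f (hf y) ⊗ₜ[𝒳.O (y : X)] exteriorPower.ιMulti (𝒳.O (y : X)) 0 Fin.elim0
  have ht : ∀ U, t U ∈ (𝒳.formGenerators 0).sections U := fun U =>
    mem_sections_of_mem_gen (X := TopCat.of X) _ ⟨f, fun y _ => hf y, Fin.elim0,
      fun j => j.elim0, fun y => congrArg (smoothGerm f (hf y) ⊗ₜ[𝒳.O (y : X)] ·)
        (congrArg _ (Subsingleton.elim _ _))⟩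
  exact ⟨⟨_, ht _⟩, ⟨⟨_, ht _⟩, fun _ => rfl⟩, fun y => ⟨hf y, rfl⟩⟩

end AnalyticVariety

theorem mainTheorem9_general {n : ℕ} {X : Type u} [TopologicalSpace X] [T2Space X]
    [ParacompactSpace X] (𝒳 : AnalyticVariety n X) :
    (∀ {ι : Type*} (B : ι → AnalyticChart X), 𝒳.IsAtlas B →
      ∃ ρ : PartitionOfUnity ι X, ρ.IsSubordinate (fun β => ((B β).A : Set X)) ∧
        (∀ β γ, ∃ R : (Fin (B γ).m → ℂ) → ℝ, ContDiffOn ℝ ∞ R (B γ).U ∧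
          ∀ w : (B γ).W, R w = ρ β ((B γ).F.symm w)) ∧
        ∀ β, 𝒳.IsExtendableZeroForm fun x => (ρ β x : ℂ)) ∧
    (∀ N N' : ℕ, (𝒳.tensorSheaf N N').IsFine ∧ (𝒳.tensorSheaf N N').IsSoft) ∧
    ∀ p : ℕ, (𝒳.formSheaf p).IsFine ∧ (𝒳.formSheaf p).IsSoft := by
  have := 𝒳.locallyCompactSpace
  refine ⟨fun B hB => ?_, fun N N' => ?_, fun p => ?_⟩
  · obtain ⟨ρ, hρB, hρ⟩ := 𝒳.isBumpAlgebra_smoothFunctions.exists_partitionOfUnity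
      (fun β => ((B β).A : Set X)) (fun β => (B β).A.isOpen) (Set.iUnion_eq_univ_iff.2 hB.2)
    exact ⟨ρ, hρB,
      fun β γ => AnalyticChart.exists_contDiffOn_extension fun x => (hρ β x).chart (hB.1 γ),
      fun β => AnalyticVariety.isExtendableZeroForm_of_smoothAt (hρ β)⟩
  · have h := (AnalyticVariety.smoothStable_tensorGenerators (𝒳 := 𝒳) N N').hasPartitionsOfUnity
    exact ⟨h.isFine, h.isSoft⟩
  · have h := (AnalyticVariety.smoothStable_formGenerators (𝒳 := 𝒳) p).hasPartitionsOfUnity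
    exact ⟨h.isFine, h.isSoft⟩

theorem mainTheorem9 {n : ℕ} {X : Type u} [TopologicalSpace X] [T2Space X]
    [SecondCountableTopology X] (𝒳 : AnalyticVariety n X) :
    (∀ {ι : Type*} (B : ι → AnalyticChart X), 𝒳.IsAtlas B →
      (∀ β, {γ | (closure ((B γ).A : Set X) ∩ ((B β).A : Set X)).Nonempty}.Finite) →
      ∃ ρ : PartitionOfUnity ι X, ρ.IsSubordinate (fun β => ((B β).A : Set X)) ∧
        (∀ β γ, ∃ R : (Fin (B γ).m → ℂ) → ℝ, ContDiffOn ℝ ∞ R (B γ).U ∧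
          ∀ w : (B γ).W, R w = ρ β ((B γ).F.symm w)) ∧
        ∀ β, 𝒳.IsExtendableZeroForm fun x => (ρ β x : ℂ)) ∧
    (∀ N N' : ℕ, (𝒳.tensorSheaf N N').IsFine ∧ (𝒳.tensorSheaf N N').IsSoft) ∧
    ∀ p : ℕ, (𝒳.formSheaf p).IsFine ∧ (𝒳.formSheaf p).IsSoft := by
  have := 𝒳.locallyCompactSpace
  obtain ⟨hpartition, hsheaves⟩ := mainTheorem9_general 𝒳
  exact ⟨fun B hB _ => hpartition B hB, hsheaves⟩
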